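/- Let $G=(V,E)$ be a finite connected (simple) graph, let $r\in V$, and put $n:=|V|-1$. Random walk on $G$ moves at each step from the current vertex to a neighbour of it chosen uniformly at random. Consider the cover tour from $r$, i.e. random walk started at $r$ and stopped once all vertices have been visited. Let the cost of a step of this tour be $1-\frac{k}{n}$, where $k$ is the number of vertices other than $r$ visited before that step, let $cc_r(G)$ be the expected total cost of all steps in the cover tour, and let $CC_r(G):=n\,cc_r(G)$ be the Cover Cost (for $|V|=1$ the tour has no steps and both values are $0$). For distinct vertices $x,y$, let $p_{xy}$ be the probability that random walk started at $x$ visits $y$ before returning to $x$ (visits at times $\ge 1$), and let $p_r(x<y)$ be the probability that random walk started at $r$ visits $x$ before $y$, where the starting position counts as a visit (so $p_r(r<y)=1$ and $p_r(x<r)=0$). Then $cc_r(G)$ is finite, $p_{xy}>0$ for all distinct $x,y\in V$, and $$CC_r(G)=\sum_{\substack{x,y\in V\\ x\ne y}}\frac{p_r(x<y)}{p_{xy}},$$ where the sum is over ordered pairs of distinct vertices. -/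

import Mathlib

open MeasureTheory ProbabilityTheory
open scoped ENNReal

namespace CoverCost

universe u

section

variable {V : Type u} [Fintype V] [DecidableEq V] [MeasurableSpace V] [DiscreteMeasurableSpace V]

/-- The law of one step of random walk from `x`: uniform on the neighbours of `x`.
(At a vertex without neighbours, which in a connected graph exists only if the graph has
one vertex, the walk stays put.) -/
noncomputable def stepPMF (G : SimpleGraph V) [DecidableRel G.Adj] (x : V) : PMF V :=
  if h : (G.neighborFinset x).Nonempty then PMF.uniformOfFinset (G.neighborFinset x) h
  else PMF.pure x

/-- The transition kernel of random walk on `G`. -/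
noncomputable def stepKernel (G : SimpleGraph V) [DecidableRel G.Adj] : Kernel V V :=
  Kernel.ofFunOfCountable fun x => (stepPMF G x).toMeasure

instance (G : SimpleGraph V) [DecidableRel G.Adj] : IsMarkovKernel (stepKernel G) :=
  ⟨fun x => inferInstanceAs (IsProbabilityMeasure (stepPMF G x).toMeasure)⟩

/-- Given the positions at times `0, …, k`, the position at time `k + 1` is chosen by a step
from the position at time `k`. -/
noncomputable def historyKernel (G : SimpleGraph V) [DecidableRel G.Adj] (k : ℕ) :
    Kernel ((i : Finset.Iic k) → (fun _ : ℕ => V) i) V :=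
  (stepKernel G).comap (fun h => h ⟨k, Finset.mem_Iic.2 le_rfl⟩) (measurable_pi_apply _)

instance (G : SimpleGraph V) [DecidableRel G.Adj] (k : ℕ) :
    IsMarkovKernel (historyKernel G k) := by
  unfold historyKernel; infer_instance

/-- The law, on the space `ℕ → V` of infinite trajectories, of random walk on `G` started
at `v`. -/
noncomputable def walkMeasure (G : SimpleGraph V) [DecidableRel G.Adj] (v : V) :
    Measure (ℕ → V) :=
  Kernel.trajMeasure (X := fun _ : ℕ => V) (Measure.dirac v) (historyKernel G)

/-- The set of vertices visited by the trajectory `ω` at times `0, …, i`. -/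
def visited (ω : ℕ → V) (i : ℕ) : Finset V :=
  (Finset.range (i + 1)).image ω

/-- The cost of the step from `ω i` to `ω (i + 1)` in the cover tour from `r`: it is
`1 - k / n`, where `k` is the number of vertices other than `r` visited before the step and
`n = |V| - 1`. There is no cost once all vertices have been visited, since then the cover tour
is over. -/
noncomputable def stepCost (r : V) (ω : ℕ → V) (i : ℕ) : ℝ :=
  if visited ω i = Finset.univ then 0
  else 1 - (((visited ω i).erase r).card : ℝ) / ((Fintype.card V : ℝ) - 1)

/-- `cc_r(G)`: the expected total cost of all steps in the cover tour from `r`. -/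
noncomputable def cc (G : SimpleGraph V) [DecidableRel G.Adj] (r : V) : ℝ≥0∞ :=
  ∫⁻ ω, ∑' i : ℕ, ENNReal.ofReal (stepCost r ω i) ∂(walkMeasure G r)

/-- `CC_r(G) = n · cc_r(G)` with `n = |V| - 1`. -/
noncomputable def CC (G : SimpleGraph V) [DecidableRel G.Adj] (r : V) : ℝ≥0∞ :=
  ((Fintype.card V - 1 : ℕ) : ℝ≥0∞) * cc G r

/-- `p_r(x<y)`: the probability that random walk from `r` visits `x` before `y`, where the
starting position counts as a visit. -/
noncomputable def probBefore (G : SimpleGraph V) [DecidableRel G.Adj] (r x y : V) : ℝ≥0∞ :=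
  walkMeasure G r {ω | ∃ k, ω k = x ∧ ∀ m ≤ k, ω m ≠ y}

/-- `p_{xy}`: the probability that random walk from `x` visits `y` before returning to `x`,
where only visits at times `≥ 1` count. -/
noncomputable def probEscape (G : SimpleGraph V) [DecidableRel G.Adj] (x y : V) : ℝ≥0∞ :=
  walkMeasure G x {ω | ∃ k, 1 ≤ k ∧ ω k = y ∧ ∀ m, 1 ≤ m → m ≤ k → ω m ≠ x}

end

end CoverCost

/-!
Scaled by `n = |V| - 1`, a step of the cover tour costs the number of vertices not yet visited, so
the Cover Cost is the sum over `y` of the expected hitting times `E_r[τ_y]`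
(`CC_eq_sum_hittingTime`). Before `τ_y` the walk is at some vertex `x ≠ y` at every time, so
`E_r[τ_y]` is the sum over `x ≠ y` of the expected number `G_y(r, x)` of visits to `x` before `τ_y`
(`sum_green`). To visit `x` before `y` the walk has to reach `x` first, which has probability
`p_r(x<y)`, and from then on the number of visits to `x` is geometric with success probability
`p_{xy}`; hence `G_y(r, x) = p_r(x<y) / p_{xy}` (`green_eq_div`), and in particular `p_{xy} ≠ 0`.

The strong Markov property is avoided. The Markov property at time `1` (`walkMeasure_map_shift`)
shows that hitting probabilities and the Green function `G_y` satisfy the linear equation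
`f = c + P f` off a boundary set, where `P` averages over the next step; by the maximum principle
on the connected graph (`nonpos_of_subharmonic`) the boundary values determine its solution
(`eq_of_poisson`). Thus `G_y(·, x)` and `p_·(x<y) G_y(x, x)`, both harmonic off `{x, y}`, are equal,
and the equation at `x` gives `G_y(x, x) p_{xy} = 1`. For these comparisons of real functions the
Green function must be finite: since uniqueness gives existence in finite dimension, the equation
for hitting times has a real solution, and it bounds the partial sums of `E_v[τ_y]`
(`hittingTime_ne_top`).
-/

namespace CoverCost

/-! ### The Markov property of the walk -/

section Markov

lemma preimage_frestrictLe_singleton {V : Type*} (w : ℕ → V) (k : ℕ) :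
    Preorder.frestrictLe (π := fun _ : ℕ => V) k ⁻¹' {Preorder.frestrictLe k w} =
      {ω | ∀ i ≤ k, ω i = w i} := by
  ext ω
  simp [funext_iff]

/-- The trajectory seen from time `1` on. -/
def shift {V : Type*} (ω : ℕ → V) : ℕ → V := fun i => ω (i + 1)

lemma measurable_shift {V : Type*} [MeasurableSpace V] : Measurable (shift : (ℕ → V) → ℕ → V) :=
  measurable_pi_lambda _ fun i => measurable_pi_apply (i + 1)

variable {V : Type*} [Fintype V] [MeasurableSpace V] [DiscreteMeasurableSpace V]

lemma measurableSet_cylinder (w : ℕ → V) (k : ℕ) :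
    MeasurableSet {ω : ℕ → V | ∀ i ≤ k, ω i = w i} := by
  measurability

/-- A finite measure on trajectories is determined by the probabilities of finite paths. -/
lemma ext_of_cylinder {μ ν : Measure (ℕ → V)} [IsFiniteMeasure μ] [IsFiniteMeasure ν]
    (h : ∀ (w : ℕ → V) (k : ℕ), μ {ω | ∀ i ≤ k, ω i = w i} = ν {ω | ∀ i ≤ k, ω i = w i}) :
    μ = ν := by
  have key : IsProjectiveLimit μ (fun I : Finset ℕ => ν.map I.restrict) := by
    rw [isProjectiveLimit_nat_iff
      (isProjectiveMeasureFamily_map_restrict fun t => (measurable_pi_apply t).aemeasurable)]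
    intro k
    refine Measure.ext_of_singleton fun a => ?_
    rcases isEmpty_or_nonempty V with hV | hV
    · exact (hV.false (a ⟨0, by simp⟩)).elim
    · obtain ⟨w, rfl⟩ : ∃ w : ℕ → V, Preorder.frestrictLe k w = a :=
        ⟨fun i => if hi : i ∈ Finset.Iic k then a ⟨i, hi⟩ else Classical.arbitrary V, by
          ext i; simp [Finset.mem_Iic.1 i.2]⟩
      have h1 : ν.map ((Finset.Iic k).restrict) = ν.map (Preorder.frestrictLe k) := rfl
      rw [h1, Measure.map_apply (by fun_prop) (measurableSet_singleton _),
        Measure.map_apply (by fun_prop) (measurableSet_singleton _),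
        preimage_frestrictLe_singleton, h]
  exact key.unique fun _ => rfl

variable (G : SimpleGraph V) [DecidableRel G.Adj]

instance (v : V) : IsProbabilityMeasure (walkMeasure G v) := by
  unfold walkMeasure; infer_instance

lemma stepKernel_singleton (x z : V) : stepKernel G x {z} = stepPMF G x z :=
  PMF.toMeasure_apply_singleton _ _ (measurableSet_singleton z)

lemma walkMeasure_map_zero (v : V) :
    (walkMeasure G v).map (Preorder.frestrictLe 0) =
      (Measure.dirac v).map (MeasurableEquiv.piUnique fun _ : Finset.Iic 0 => V).symm := by
  unfold walkMeasure Kernel.trajMeasure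
  rw [Measure.map_comp _ _ (by fun_prop), Kernel.traj_map_frestrictLe, Kernel.partialTraj_self,
    Measure.id_comp]

/-- The walk from `v` is at `v` at time `0`. -/
lemma walkMeasure_zero (v : V) : ∀ᵐ ω ∂walkMeasure G v, ω 0 = v := by
  have h := congrArg (fun μ => μ {x | x ⟨0, by simp⟩ = v}ᶜ) (walkMeasure_map_zero G v)
  have hm : MeasurableSet {x : (i : Finset.Iic 0) → V | x ⟨0, by simp⟩ = v}ᶜ :=
    Set.Finite.measurableSet (Set.toFinite _)
  beta_reduce at h
  rw [Measure.map_apply (by fun_prop) hm, Measure.map_apply (by fun_prop) hm,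
    Measure.dirac_apply' _ (MeasurableSet.of_discrete)] at h
  rw [ae_iff]
  refine h.trans ?_
  simp [MeasurableEquiv.piUnique]

lemma walkMeasure_eq_one {v : V} {A : Set (ℕ → V)} (h : ∀ ω : ℕ → V, ω 0 = v → ω ∈ A) :
    walkMeasure G v A = 1 := by
  rw [← measure_univ (μ := walkMeasure G v)]
  refine measure_congr ?_
  filter_upwards [walkMeasure_zero G v] with ω hω
  exact propext (iff_true_intro (h ω hω))

lemma walkMeasure_eq_zero {v : V} {A : Set (ℕ → V)} (h : ∀ ω : ℕ → V, ω 0 = v → ω ∉ A) :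
    walkMeasure G v A = 0 :=
  measure_mono_null (fun ω hω hv => h ω hv hω) (walkMeasure_zero G v)

/-- The Markov property, for finite paths. -/
lemma walkMeasure_cylinder_succ (v : V) (w : ℕ → V) (k : ℕ) :
    walkMeasure G v {ω | ∀ i ≤ k + 1, ω i = w i} =
      walkMeasure G v {ω | ∀ i ≤ k, ω i = w i} * stepPMF G (w k) (w (k + 1)) := by
  have h := Kernel.map_frestrictLe_trajMeasure_compProd_eq_map_trajMeasure
    (X := fun _ : ℕ => V) (μ₀ := Measure.dirac v) (κ := historyKernel G) (a := k)
  have h2 := congrArg (fun μ => μ ({Preorder.frestrictLe k w} ×ˢ {w (k + 1)})) h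
  beta_reduce at h2
  rw [Measure.compProd_apply_prod (measurableSet_singleton _) (measurableSet_singleton _),
    Measure.map_apply (by fun_prop)
      ((measurableSet_singleton _).prod (measurableSet_singleton _)),
    lintegral_singleton, Measure.map_apply (by fun_prop) (measurableSet_singleton _),
    preimage_frestrictLe_singleton, mul_comm] at h2
  have h3 : historyKernel G k (Preorder.frestrictLe k w) {w (k + 1)} =
      stepPMF G (w k) (w (k + 1)) := by
    rw [historyKernel, Kernel.comap_apply, stepKernel_singleton]
    rfl
  rw [h3] at h2
  refine Eq.trans (congrArg _ ?_) h2.symm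
  ext ω
  simp only [Set.mem_ofPred_eq, Set.mem_preimage, Set.mem_prod, Set.mem_singleton_iff,
    funext_iff, Subtype.forall, Finset.mem_Iic, Preorder.frestrictLe_apply, Nat.le_succ_iff]
  constructor
  · exact fun h => ⟨fun i hi => h i (Or.inl hi), h _ (Or.inr rfl)⟩
  · rintro ⟨h, h'⟩ i (hi | rfl)
    exacts [h i hi, h']

/-- Probability of a shifted path: the first step goes from `v` to `w 0`. -/
lemma walkMeasure_shift_cylinder (v : V) (w : ℕ → V) (k : ℕ) :
    walkMeasure G v (shift ⁻¹' {ω | ∀ i ≤ k, ω i = w i}) =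
      stepPMF G v (w 0) * walkMeasure G (w 0) {ω | ∀ i ≤ k, ω i = w i} := by
  have h1 : walkMeasure G v (shift ⁻¹' {ω | ∀ i ≤ k, ω i = w i}) =
      walkMeasure G v {ω | ∀ i ≤ k + 1, ω i = (fun n => Nat.casesOn n v w : ℕ → V) i} := by
    refine measure_congr ?_
    filter_upwards [walkMeasure_zero G v] with ω hω
    refine propext ⟨fun h i hi => ?_, fun h i hi => h (i + 1) (by omega)⟩
    cases i with
    | zero => exact hω
    | succ j => exact h j (by omega)
  rw [h1]
  clear h1
  induction k with
  | zero =>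
    rw [walkMeasure_cylinder_succ, walkMeasure_eq_one G (by simp +contextual),
      walkMeasure_eq_one G (by simp +contextual), one_mul, mul_one]
    rfl
  | succ k ih => rw [walkMeasure_cylinder_succ, ih, walkMeasure_cylinder_succ G (w 0), mul_assoc]

/-- The Markov property at time `1`: conditionally on its first step, the walk from `v` goes on
as the walk from its new position. -/
theorem walkMeasure_map_shift (v : V) :
    (walkMeasure G v).map shift = ∑ z, stepPMF G v z • walkMeasure G z := by
  have : IsFiniteMeasure (∑ z, stepPMF G v z • walkMeasure G z) := by
    constructor
    rw [Measure.finsetSum_apply]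
    simp only [Measure.smul_apply, measure_univ, smul_eq_mul, mul_one]
    exact ENNReal.sum_lt_top.2 fun z _ => (stepPMF G v).apply_lt_top z
  have := Measure.isProbabilityMeasure_map (μ := walkMeasure G v)
    (measurable_shift (V := V)).aemeasurable
  refine ext_of_cylinder fun w k => ?_
  rw [Measure.map_apply measurable_shift (measurableSet_cylinder w k), walkMeasure_shift_cylinder,
    Measure.finsetSum_apply]
  simp only [Measure.smul_apply, smul_eq_mul]
  rw [Finset.sum_eq_single (w 0) (fun z _ hz => ?_) fun h => absurd (Finset.mem_univ _) h]
  rw [walkMeasure_eq_zero G (A := {ω | ∀ i ≤ k, ω i = w i})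
    fun ω hω h => hz (hω.symm.trans (h 0 (Nat.zero_le k))), mul_zero]

/-- First step analysis: if, for trajectories from `v`, the event `A` says that the event `B`
occurs from time `1` on, then the probability of `A` averages that of `B` over the first step. -/
lemma walkMeasure_first_step {v : V} {A B : Set (ℕ → V)} (hB : MeasurableSet B)
    (h : ∀ ω : ℕ → V, ω 0 = v → (ω ∈ A ↔ shift ω ∈ B)) :
    walkMeasure G v A = ∑ z, stepPMF G v z * walkMeasure G z B := by
  have h1 : walkMeasure G v A = walkMeasure G v (shift ⁻¹' B) := by
    refine measure_congr ?_
    filter_upwards [walkMeasure_zero G v] with ω hω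
    exact propext (h ω hω)
  rw [h1, ← Measure.map_apply measurable_shift hB, walkMeasure_map_shift]
  simp

end Markov

/-! ### Harmonic functions and the maximum principle -/

section Harmonic

variable {V : Type*} [Fintype V] (G : SimpleGraph V) [DecidableRel G.Adj]

/-- The transition probability from `x` to `z`, as a real number. -/
noncomputable def stepProb (x z : V) : ℝ := (stepPMF G x z).toReal

lemma stepProb_nonneg (x z : V) : 0 ≤ stepProb G x z := ENNReal.toReal_nonneg

lemma ofReal_stepProb (x z : V) : ENNReal.ofReal (stepProb G x z) = stepPMF G x z :=
  ENNReal.ofReal_toReal ((stepPMF G x).apply_ne_top z)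

lemma sum_stepProb (x : V) : ∑ z, stepProb G x z = 1 := by
  unfold stepProb
  have h := (stepPMF G x).tsum_coe
  rw [tsum_fintype] at h
  rw [← ENNReal.toReal_sum fun z _ => (stepPMF G x).apply_ne_top z, h, ENNReal.toReal_one]

lemma toReal_sum_stepPMF_mul (v : V) {f : V → ℝ≥0∞} (hf : ∀ z, f z ≠ ∞) :
    (∑ z, stepPMF G v z * f z).toReal = ∑ z, stepProb G v z * (f z).toReal := by
  rw [ENNReal.toReal_sum fun z _ => ENNReal.mul_ne_top ((stepPMF G v).apply_ne_top z) (hf z)]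
  simp only [ENNReal.toReal_mul, stepProb]

variable {G} in
lemma stepProb_pos {x z : V} (h : G.Adj x z) : 0 < stepProb G x z := by
  have hz : z ∈ G.neighborFinset x := by simpa using h
  refine ENNReal.toReal_pos ?_ ((stepPMF G x).apply_ne_top z)
  rw [stepPMF, dif_pos ⟨z, hz⟩]
  exact (PMF.mem_support_uniformOfFinset_iff _ z).2 hz

/-- Maximum principle: a function that off a nonempty set `S` is at most its average over the
next step of the walk is nonpositive as soon as it is nonpositive on `S`. -/
theorem nonpos_of_subharmonic (hG : G.Connected) {S : Set V} (hS : S.Nonempty) {f : V → ℝ}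
    (hf : ∀ v ∉ S, f v ≤ ∑ z, stepProb G v z * f z) (hfS : ∀ v ∈ S, f v ≤ 0) (v : V) :
    f v ≤ 0 := by
  have := hG.nonempty
  obtain ⟨m, hm⟩ := Finite.exists_max f
  by_contra! hv
  have hmpos : 0 < f m := hv.trans_le (hm v)
  -- the set where `f` attains its maximum misses `S`, so it is closed under adjacency
  have step : ∀ {a b : V}, G.Adj a b → f a = f m → f b = f m := by
    intro a b hab ha
    have haS : a ∉ S := fun h => (hfS a h).not_gt (ha ▸ hmpos)
    have h0 : ∑ z, stepProb G a z * (f m - f z) ≤ 0 := by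
      simp only [mul_sub, Finset.sum_sub_distrib, ← Finset.sum_mul, sum_stepProb, one_mul]
      linarith [hf a haS]
    have h1 := Finset.single_le_sum (f := fun z => stepProb G a z * (f m - f z))
      (fun z _ => mul_nonneg (stepProb_nonneg G a z) (sub_nonneg.2 (hm z))) (Finset.mem_univ b)
    have h2 := nonpos_of_mul_nonpos_right (h1.trans h0) (stepProb_pos hab)
    linarith [hm b]
  obtain ⟨s, hs⟩ := hS
  have hms : f s = f m := by
    obtain ⟨p⟩ := hG.preconnected m s
    have : ∀ {a b : V}, G.Walk a b → f a = f m → f b = f m := by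
      intro a b p
      induction p with
      | nil => exact id
      | cons h _ ih => exact fun ha => ih (step h ha)
    exact this p rfl
  linarith [hfS s hs]

/-- Two functions that satisfy the same equation `f = c + P f` off a nonempty set `S` and agree
on `S` are equal. -/
theorem eq_of_poisson (hG : G.Connected) {S : Set V} (hS : S.Nonempty) {f g c : V → ℝ}
    (hf : ∀ v ∉ S, f v = c v + ∑ z, stepProb G v z * f z)
    (hg : ∀ v ∉ S, g v = c v + ∑ z, stepProb G v z * g z) (hfg : ∀ v ∈ S, f v = g v) :
    f = g := by
  have key : ∀ {f g : V → ℝ}, (∀ v ∉ S, f v = c v + ∑ z, stepProb G v z * f z) →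
      (∀ v ∉ S, g v = c v + ∑ z, stepProb G v z * g z) → (∀ v ∈ S, f v = g v) →
      ∀ v, f v ≤ g v := by
    intro f g hf hg hfg v
    have := nonpos_of_subharmonic G hG hS (f := fun v => f v - g v) (fun v hv => ?_)
      (fun v hv => by simp [hfg v hv]) v
    · linarith
    · simp only [mul_sub, Finset.sum_sub_distrib]
      linarith [hf v hv, hg v hv]
  exact funext fun v => le_antisymm (key hf hg hfg v) (key hg hf (fun v hv => (hfg v hv).symm) v)

/-- The equation `f = 1 + P f` off `y`, `f y = 0`, which the expected hitting times of `y`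
satisfy, has a nonnegative real solution. -/
theorem exists_hittingTime_solution (hG : G.Connected) (y : V) :
    ∃ f : V → ℝ, (∀ v, 0 ≤ f v) ∧ ∀ v, v ≠ y → f v = 1 + ∑ z, stepProb G v z * f z := by
  classical
  let L : (V → ℝ) →ₗ[ℝ] (V → ℝ) :=
    { toFun := fun f v => if v = y then f y else f v - ∑ z, stepProb G v z * f z
      map_add' := fun f g => by
        ext v
        simp only [Pi.add_apply, mul_add, Finset.sum_add_distrib]
        split_ifs <;> ring
      map_smul' := fun a f => by
        ext v
        simp only [Pi.smul_apply, smul_eq_mul, RingHom.id_apply, mul_left_comm _ a,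
          ← Finset.mul_sum]
        split_ifs <;> ring }
  have hL (f : V → ℝ) (v : V) :
      L f v = if v = y then f y else f v - ∑ z, stepProb G v z * f z := rfl
  -- `L` is injective by the maximum principle, hence surjective
  have hinj : Function.Injective L := by
    refine (injective_iff_map_eq_zero L).2 fun f hf => ?_
    refine eq_of_poisson G hG (S := {y}) (Set.singleton_nonempty y) (c := 0) (fun v hv => ?_)
      (fun v _ => by simp) (fun v hv => ?_)
    · have := congrFun hf v
      rw [hL, if_neg (by simpa using hv)] at this
      simp only [Pi.zero_apply] at this ⊢
      linarith
    · rw [Set.mem_singleton_iff.1 hv]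
      simpa [hL] using congrFun hf y
  obtain ⟨f, hf⟩ := (LinearMap.injective_iff_surjective.1 hinj) (fun v => if v = y then 0 else 1)
  have hfy : f y = 0 := by simpa [hL] using congrFun hf y
  have hfv (v : V) (hv : v ≠ y) : f v = 1 + ∑ z, stepProb G v z * f z := by
    have := congrFun hf v
    simp only [hL, if_neg hv] at this
    linarith
  refine ⟨f, fun v => ?_, hfv⟩
  have := nonpos_of_subharmonic G hG (Set.singleton_nonempty y) (f := fun v => -f v)
    (fun v hv => ?_) (fun v hv => ?_) v
  · linarith
  · simp only [mul_neg, Finset.sum_neg_distrib]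
    linarith [hfv v hv]
  · rw [Set.mem_singleton_iff.1 hv, hfy, neg_zero]

end Harmonic

/-! ### Hitting times and the Green function -/

section HittingTimes

lemma forall_le_succ_ne {V : Type*} {ω : ℕ → V} {y v : V} (h0 : ω 0 = v) (hv : v ≠ y) (i : ℕ) :
    (∀ m ≤ i + 1, ω m ≠ y) ↔ ∀ m ≤ i, shift ω m ≠ y := by
  refine ⟨fun h m hm => h (m + 1) (by omega), fun h m hm => ?_⟩
  cases m with
  | zero => rwa [h0]
  | succ m => exact h m (by omega)

variable {V : Type*} [Fintype V] [MeasurableSpace V] [DiscreteMeasurableSpace V]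
  (G : SimpleGraph V) [DecidableRel G.Adj]

/-- The expected time at which the walk from `v` hits `y`, as the sum over `i` of the probability
that `y` is not visited by time `i`. -/
noncomputable def hittingTime (v y : V) : ℝ≥0∞ :=
  ∑' i : ℕ, walkMeasure G v {ω | ∀ m ≤ i, ω m ≠ y}

/-- The Green function of the walk killed at `y`: the expected number of visits of the walk from
`v` to `x` before its first visit to `y`. -/
noncomputable def green (y v x : V) : ℝ≥0∞ :=
  ∑' i : ℕ, walkMeasure G v {ω | ω i = x ∧ ∀ m ≤ i, ω m ≠ y}

lemma measurableSet_avoid (y : V) (i : ℕ) :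
    MeasurableSet {ω : ℕ → V | ∀ m ≤ i, ω m ≠ y} := by
  measurability

lemma measurableSet_visit (x y : V) (i : ℕ) :
    MeasurableSet {ω : ℕ → V | ω i = x ∧ ∀ m ≤ i, ω m ≠ y} := by
  measurability

lemma measurableSet_before (x y : V) :
    MeasurableSet {ω : ℕ → V | ∃ k, ω k = x ∧ ∀ m ≤ k, ω m ≠ y} := by
  measurability

/-- At every time at which the walk has not yet visited `y`, it is somewhere. -/
lemma sum_green (y v : V) : ∑ x, green G y v x = hittingTime G v y := by
  unfold green hittingTime
  rw [← Summable.tsum_finsetSum fun _ _ => ENNReal.summable]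
  refine tsum_congr fun i => ?_
  rw [← measure_biUnion_finset (fun a _ b _ hab => ?_) fun x _ => measurableSet_visit x y i]
  · congr 1
    ext ω
    simp
  · exact Set.disjoint_left.2 fun ω ha hb => hab (ha.1.symm.trans hb.1)

lemma walkMeasure_avoid_self (y : V) (i : ℕ) : walkMeasure G y {ω | ∀ m ≤ i, ω m ≠ y} = 0 :=
  walkMeasure_eq_zero G fun _ h0 h => h 0 (Nat.zero_le i) h0

lemma walkMeasure_avoid_succ {v y : V} (hv : v ≠ y) (i : ℕ) :
    walkMeasure G v {ω | ∀ m ≤ i + 1, ω m ≠ y} =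
      ∑ z, stepPMF G v z * walkMeasure G z {ω | ∀ m ≤ i, ω m ≠ y} :=
  walkMeasure_first_step G (measurableSet_avoid y i) fun _ h0 => forall_le_succ_ne h0 hv i

/-- The expected hitting time of any vertex is finite: its partial sums are bounded by the
solution of the equation that the hitting times satisfy. -/
theorem hittingTime_ne_top (hG : G.Connected) (v y : V) : hittingTime G v y ≠ ∞ := by
  obtain ⟨f, hf0, hf⟩ := exists_hittingTime_solution G hG y
  suffices h : hittingTime G v y ≤ ENNReal.ofReal (f v) from ne_top_of_le_ne_top
    ENNReal.ofReal_ne_top h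
  refine ENNReal.tsum_le_of_sum_range_le fun n => ?_
  induction n generalizing v with
  | zero => simp
  | succ n ih =>
    by_cases hv : v = y
    · subst hv
      simp [walkMeasure_avoid_self]
    · rw [Finset.sum_range_succ', hf v hv, add_comm, ENNReal.ofReal_add zero_le_one
        (Finset.sum_nonneg fun z _ => mul_nonneg (stepProb_nonneg G v z) (hf0 z)),
        ENNReal.ofReal_one]
      refine add_le_add prob_le_one ?_
      rw [ENNReal.ofReal_sum_of_nonneg
        fun z _ => mul_nonneg (stepProb_nonneg G v z) (hf0 z)]
      simp_rw [ENNReal.ofReal_mul (stepProb_nonneg G v _), ofReal_stepProb]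
      rw [Finset.sum_congr rfl fun i _ => walkMeasure_avoid_succ G hv i, Finset.sum_comm]
      refine Finset.sum_le_sum fun z _ => ?_
      rw [← Finset.mul_sum]
      exact mul_le_mul_right (ih z) _

lemma green_ne_top (hG : G.Connected) (y v x : V) : green G y v x ≠ ∞ := by
  refine ne_top_of_le_ne_top (hittingTime_ne_top G hG v y) ?_
  rw [← sum_green]
  exact Finset.single_le_sum (f := fun x => green G y v x) (fun _ _ => zero_le)
    (Finset.mem_univ x)

lemma green_start_self (y x : V) : green G y y x = 0 :=
  ENNReal.tsum_eq_zero.2 fun i => walkMeasure_eq_zero G fun _ h0 h => h.2 0 (Nat.zero_le i) h0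

lemma green_target_self (y v : V) : green G y v y = 0 :=
  ENNReal.tsum_eq_zero.2 fun i => walkMeasure_eq_zero G fun _ _ h => h.2 i le_rfl h.1

lemma green_first_step [DecidableEq V] {y v : V} (hv : v ≠ y) (x : V) :
    green G y v x = (if v = x then 1 else 0) + ∑ z, stepPMF G v z * green G y z x := by
  unfold green
  rw [tsum_eq_zero_add' ENNReal.summable]
  congr 1
  · split_ifs with h
    · exact walkMeasure_eq_one G fun ω h0 =>
        ⟨h0.trans h, fun m hm => by rwa [Nat.le_zero.1 hm, h0]⟩
    · exact walkMeasure_eq_zero G fun ω h0 hω => h (h0.symm.trans hω.1)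
  · simp_rw [← ENNReal.tsum_mul_left]
    rw [← Summable.tsum_finsetSum fun _ _ => ENNReal.summable]
    exact tsum_congr fun i => walkMeasure_first_step G (measurableSet_visit x y i)
      fun ω h0 => and_congr Iff.rfl (forall_le_succ_ne h0 hv i)

lemma probBefore_ne_top (v x y : V) : probBefore G v x y ≠ ∞ := measure_ne_top _ _

lemma probEscape_ne_top (x y : V) : probEscape G x y ≠ ∞ := measure_ne_top _ _

lemma probBefore_start_first {x y : V} (h : x ≠ y) : probBefore G x x y = 1 :=
  walkMeasure_eq_one G fun ω h0 => ⟨0, h0, fun m hm => by rwa [Nat.le_zero.1 hm, h0]⟩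

lemma probBefore_start_second (x y : V) : probBefore G y x y = 0 :=
  walkMeasure_eq_zero G fun _ h0 ⟨k, _, h⟩ => h 0 (Nat.zero_le k) h0

lemma probBefore_first_step {v x y : V} (hx : v ≠ x) (hy : v ≠ y) :
    probBefore G v x y = ∑ z, stepPMF G v z * probBefore G z x y := by
  refine walkMeasure_first_step G (measurableSet_before x y) fun ω h0 => ⟨?_, ?_⟩
  · rintro ⟨_ | k, hk, h⟩
    · exact absurd (h0.symm.trans hk) hx
    · exact ⟨k, hk, (forall_le_succ_ne h0 hy k).1 h⟩
  · rintro ⟨k, hk, h⟩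
    exact ⟨k + 1, hk, (forall_le_succ_ne h0 hy k).2 h⟩

lemma probEscape_eq_sum (x y : V) :
    probEscape G x y = ∑ z, stepPMF G x z * probBefore G z y x := by
  refine walkMeasure_first_step G (measurableSet_before y x) fun ω _ => ⟨?_, ?_⟩
  · rintro ⟨k, hk1, hk, h⟩
    obtain ⟨k, rfl⟩ := Nat.exists_eq_add_of_le' hk1
    exact ⟨k, hk, fun m hm => h (m + 1) (by omega) (by omega)⟩
  · rintro ⟨k, hk, h⟩
    refine ⟨k + 1, by omega, hk, fun m hm1 hm => ?_⟩
    obtain ⟨m, rfl⟩ := Nat.exists_eq_add_of_le' hm1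
    exact h m (by omega)

/-- The walk almost surely visits `x` or `y`, so it visits one of them before the other: both
sides are harmonic off `{x, y}`. -/
lemma probBefore_add_probBefore (hG : G.Connected) {x y : V} (hxy : x ≠ y) (v : V) :
    (probBefore G v x y).toReal + (probBefore G v y x).toReal = 1 := by
  refine congrFun (eq_of_poisson G hG (S := {x, y}) ⟨x, by simp⟩ (c := 0)
    (f := fun v => (probBefore G v x y).toReal + (probBefore G v y x).toReal) (g := fun _ => 1)
    (fun v hv => ?_) (fun v _ => ?_) fun v hv => ?_) v
  · simp only [Set.mem_insert_iff, Set.mem_singleton_iff, not_or] at hv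
    rw [probBefore_first_step G hv.1 hv.2, probBefore_first_step G hv.2 hv.1,
      toReal_sum_stepPMF_mul G v fun z => probBefore_ne_top G z _ _,
      toReal_sum_stepPMF_mul G v fun z => probBefore_ne_top G z _ _]
    simp only [mul_add, Finset.sum_add_distrib, Pi.zero_apply, zero_add]
  · simp [sum_stepProb]
  · rcases hv with rfl | rfl
    · simp [probBefore_start_first G hxy, probBefore_start_second]
    · simp [probBefore_start_first G hxy.symm, probBefore_start_second]

/-- To visit `x` before `y`, the walk has to get to `x` before `y`, and it then starts afresh. -/
lemma green_eq_probBefore_mul (hG : G.Connected) {x y : V} (hxy : x ≠ y) (v : V) :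
    green G y v x = probBefore G v x y * green G y x x := by
  classical
  rw [← ENNReal.toReal_eq_toReal_iff' (green_ne_top G hG y v x)
    (ENNReal.mul_ne_top (probBefore_ne_top G v x y) (green_ne_top G hG y x x)),
    ENNReal.toReal_mul]
  refine congrFun (eq_of_poisson G hG (S := {x, y}) ⟨x, by simp⟩ (c := 0)
    (f := fun v => (green G y v x).toReal)
    (g := fun v => (probBefore G v x y).toReal * (green G y x x).toReal)
    (fun v hv => ?_) (fun v hv => ?_) fun v hv => ?_) v
  · simp only [Set.mem_insert_iff, Set.mem_singleton_iff, not_or] at hv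
    rw [green_first_step G hv.2, if_neg hv.1, zero_add,
      toReal_sum_stepPMF_mul G v fun z => green_ne_top G hG y z x]
    simp
  · simp only [Set.mem_insert_iff, Set.mem_singleton_iff, not_or] at hv
    rw [probBefore_first_step G hv.1 hv.2,
      toReal_sum_stepPMF_mul G v fun z => probBefore_ne_top G z _ _]
    simp only [Finset.sum_mul, Pi.zero_apply, zero_add, mul_assoc]
  · rcases hv with rfl | rfl
    · simp [probBefore_start_first G hxy]
    · simp [green_start_self, probBefore_start_second]

/-- The number of visits to `x` of the walk from `x` killed at `y` is geometric: after each visit,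
the walk escapes to `y` without returning with probability `p_{xy}`. -/
lemma green_self_mul_probEscape (hG : G.Connected) {x y : V} (hxy : x ≠ y) :
    green G y x x * probEscape G x y = 1 := by
  classical
  rw [← ENNReal.toReal_eq_toReal_iff' (ENNReal.mul_ne_top (green_ne_top G hG y x x)
    (probEscape_ne_top G x y)) ENNReal.one_ne_top, ENNReal.toReal_mul, ENNReal.toReal_one]
  have hp : (probEscape G x y).toReal =
      1 - ∑ z, stepProb G x z * (probBefore G z x y).toReal := by
    rw [probEscape_eq_sum, toReal_sum_stepPMF_mul G x fun z => probBefore_ne_top G z _ _,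
      eq_sub_iff_add_eq, ← Finset.sum_add_distrib, ← sum_stepProb G x]
    refine Finset.sum_congr rfl fun z _ => ?_
    rw [← mul_add, probBefore_add_probBefore G hG hxy.symm, mul_one]
  have hg : (green G y x x).toReal =
      1 + (∑ z, stepProb G x z * (probBefore G z x y).toReal) * (green G y x x).toReal := by
    conv_lhs =>
      rw [green_first_step G hxy, if_pos rfl, ENNReal.toReal_add ENNReal.one_ne_top
        (ENNReal.sum_ne_top.2 fun z _ => ENNReal.mul_ne_top ((stepPMF G x).apply_ne_top z)
          (green_ne_top G hG y z x)), ENNReal.toReal_one,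
        toReal_sum_stepPMF_mul G x fun z => green_ne_top G hG y z x]
    rw [Finset.sum_mul]
    congr 1
    refine Finset.sum_congr rfl fun z _ => ?_
    rw [green_eq_probBefore_mul G hG hxy z, ENNReal.toReal_mul, mul_assoc]
  rw [hp]
  linear_combination hg

lemma green_eq_div (hG : G.Connected) {x y : V} (hxy : x ≠ y) (v : V) :
    green G y v x = probBefore G v x y / probEscape G x y := by
  rw [green_eq_probBefore_mul G hG hxy, div_eq_mul_inv,
    ENNReal.eq_inv_of_mul_eq_one_left (green_self_mul_probEscape G hG hxy)]

theorem hittingTime_eq_sum [DecidableEq V] (hG : G.Connected) (v y : V) :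
    hittingTime G v y =
      ∑ x ∈ Finset.univ.erase y, probBefore G v x y / probEscape G x y := by
  rw [← sum_green, ← Finset.sum_erase _ (green_target_self G y v)]
  exact Finset.sum_congr rfl fun x hx => green_eq_div G hG (Finset.ne_of_mem_erase hx) v

end HittingTimes

/-! ### Cover Cost and hitting times -/

section Cost

lemma mem_visited {V : Type*} [DecidableEq V] {ω : ℕ → V} {i : ℕ} {y : V} : y ∈ visited ω i ↔ ∃ m ≤ i, ω m = y := by
  simp [visited]

variable {V : Type*} [Fintype V] [DecidableEq V]

/-- The number of unvisited vertices as a sum of indicators. -/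
lemma sum_indicator_avoid (ω : ℕ → V) (i : ℕ) :
    ∑ y, {ω : ℕ → V | ∀ m ≤ i, ω m ≠ y}.indicator (1 : (ℕ → V) → ℝ≥0∞) ω =
      ((visited ω i)ᶜ.card : ℝ≥0∞) := by
  have (y : V) : {ω : ℕ → V | ∀ m ≤ i, ω m ≠ y}.indicator (1 : (ℕ → V) → ℝ≥0∞) ω =
      if y ∈ (visited ω i)ᶜ then 1 else 0 := by
    simp [Set.indicator_apply, mem_visited]
  simp only [this, Finset.sum_boole, Finset.filter_univ_mem]

/-- After scaling by `n = |V| - 1`, a step of the cover tour costs the number of vertices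
not yet visited. -/
lemma card_sub_one_mul_stepCost {r : V} {ω : ℕ → V} (h0 : ω 0 = r) (i : ℕ) :
    ((Fintype.card V - 1 : ℕ) : ℝ≥0∞) * ENNReal.ofReal (stepCost r ω i) =
      ((visited ω i)ᶜ.card : ℝ≥0∞) := by
  unfold stepCost
  split_ifs with h
  · simp [h]
  · have hr : r ∈ visited ω i := mem_visited.2 ⟨0, Nat.zero_le i, h0⟩
    have hlt : (visited ω i).card < Fintype.card V := (Finset.card_lt_iff_ne_univ _).2 h
    have hpos : 0 < (visited ω i).card := Finset.card_pos.2 ⟨r, hr⟩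
    rw [← ENNReal.ofReal_natCast, ← ENNReal.ofReal_mul (Nat.cast_nonneg _),
      ← ENNReal.ofReal_natCast, Finset.card_erase_of_mem hr, Finset.card_compl,
      Nat.cast_sub hlt.le, Nat.cast_sub (by omega), Nat.cast_sub (by omega), Nat.cast_one]
    congr 1
    have : (Fintype.card V : ℝ) - 1 ≠ 0 := by
      have : (1 : ℝ) < Fintype.card V := by exact_mod_cast (by omega : 1 < Fintype.card V)
      linarith
    field_simp
    ring

lemma stepCost_le (r : V) (ω : ℕ → V) (i : ℕ) :
    ENNReal.ofReal (stepCost r ω i) ≤ ((visited ω i)ᶜ.card : ℝ≥0∞) := by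
  unfold stepCost
  split_ifs with h
  · simp
  · have hcard : 1 ≤ (visited ω i)ᶜ.card := by
      rw [Nat.one_le_iff_ne_zero, Finset.card_ne_zero, Finset.nonempty_iff_ne_empty]
      simpa using h
    have hV : (1 : ℝ) ≤ Fintype.card V := by
      exact_mod_cast Fintype.card_pos_iff.2 ⟨r⟩
    refine le_trans (ENNReal.ofReal_le_one.2 ?_) (by exact_mod_cast hcard)
    exact sub_le_self _ (div_nonneg (Nat.cast_nonneg _) (sub_nonneg.2 hV))

variable [MeasurableSpace V] [DiscreteMeasurableSpace V] (G : SimpleGraph V) [DecidableRel G.Adj]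

/-- The expected number of unvisited vertices, summed over all times, is the sum of the expected
hitting times. -/
lemma lintegral_card_unvisited (r : V) :
    ∫⁻ ω, ∑' i : ℕ, ((visited ω i)ᶜ.card : ℝ≥0∞) ∂(walkMeasure G r) =
      ∑ y, hittingTime G r y := by
  have hm (i : ℕ) (y : V) : Measurable
      ({ω : ℕ → V | ∀ m ≤ i, ω m ≠ y}.indicator (1 : (ℕ → V) → ℝ≥0∞)) :=
    measurable_one.indicator (measurableSet_avoid y i)
  simp_rw [← sum_indicator_avoid]
  rw [lintegral_tsum fun i => (Finset.measurable_fun_sum _ fun y _ => hm i y).aemeasurable]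
  unfold hittingTime
  rw [← Summable.tsum_finsetSum fun _ _ => ENNReal.summable]
  refine tsum_congr fun i => ?_
  rw [lintegral_finsetSum _ fun y _ => hm i y]
  exact Finset.sum_congr rfl fun y _ => lintegral_indicator_one (measurableSet_avoid y i)

theorem CC_eq_sum_hittingTime (r : V) : CC G r = ∑ y, hittingTime G r y := by
  rw [CC, cc, ← lintegral_card_unvisited, ← lintegral_const_mul' _ _ (ENNReal.natCast_ne_top _)]
  refine lintegral_congr_ae ?_
  filter_upwards [walkMeasure_zero G r] with ω h0
  rw [← ENNReal.tsum_mul_left]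
  exact tsum_congr fun i => card_sub_one_mul_stepCost h0 i

theorem cc_ne_top (hG : G.Connected) (r : V) : cc G r ≠ ∞ := by
  have h : ∑ y, hittingTime G r y ≠ ∞ :=
    ENNReal.sum_ne_top.2 fun y _ => hittingTime_ne_top G hG r y
  refine ne_top_of_le_ne_top h ?_
  rw [← lintegral_card_unvisited, cc]
  exact lintegral_mono fun ω => ENNReal.tsum_le_tsum fun i => stepCost_le r ω i

end Cost

end CoverCost

/-- For a finite connected graph `G` and a start vertex `r`, the Cover Cost `CC_r(G)` is finite
and is the sum of `p_r(x<y) / p_{xy}` over all ordered pairs of distinct vertices `x, y`, where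
all denominators are positive. -/
theorem theorem1 {V : Type*} [Fintype V] [DecidableEq V] [MeasurableSpace V]
    [DiscreteMeasurableSpace V] (G : SimpleGraph V) [DecidableRel G.Adj] (hG : G.Connected)
    (r : V) :
    (∀ x y : V, x ≠ y → 0 < CoverCost.probEscape G x y) ∧
    CoverCost.cc G r ≠ ∞ ∧
    CoverCost.CC G r =
      ∑ x : V, ∑ y ∈ Finset.univ.erase x,
        CoverCost.probBefore G r x y / CoverCost.probEscape G x y := by
  refine ⟨fun x y hxy => pos_iff_ne_zero.2 fun h => ?_, CoverCost.cc_ne_top G hG r, ?_⟩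
  · have := CoverCost.green_self_mul_probEscape G hG hxy
    simp [h] at this
  · rw [CoverCost.CC_eq_sum_hittingTime,
      Finset.sum_congr rfl fun y _ => CoverCost.hittingTime_eq_sum G hG r y]
    refine Finset.sum_comm' fun x y => ?_
    simp [ne_comm]
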